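/- Let $G$ be a finite group. Write $\mathrm{cd}(G)$ for the set of degrees $\chi(1)$ of the irreducible complex characters $\chi$ of $G$, $\mathrm{cd}(G)^*=\mathrm{cd}(G)\setminus\{1\}$, and $\rho(G)$ for the set of primes dividing some element of $\mathrm{cd}(G)^*$. The bipartite divisor graph $B(G)$ has vertex set the disjoint union $\rho(G)\amalg\mathrm{cd}(G)^*$, and a prime $p\in\rho(G)$ is adjacent to $d\in\mathrm{cd}(G)^*$ if and only if $p\mid d$. The group $G$ is said to be of Lewis type $4$ if, for some prime $p$, $G$ is a semidirect product $V\rtimes H$, where $V$ is an elementary abelian $p$-group, such that, writing $Z=C_H(V)$, $K=F(H)$ for the Fitting subgroup of $H$, and $m=|H:K|$: $m>1$; $|V|=q^m$ for some power $q>1$ of $p$; $Z\le Z(H)$; $K/Z$ is abelian; $K$ acts irreducibly on $V$; $m$ and $|K:Z|$ are coprime; and $(q^m-1)/(q-1)$ divides $|K:Z|$. Lemma. Suppose that $B(G)$ is isomorphic, by an isomorphism respecting the bipartition into primes and degrees, to the graph with two prime vertices $x_1,x_2$ and three degree vertices $y_1,y_2,y_3$ whose edges are exactly $x_1y_1$,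 $x_1y_2$ and $x_2y_3$. Then $G$ is not of Lewis type $4$. -/

import Mathlib

/-- `Irr(G)`: the set of irreducible complex characters of `G`. -/
def irreducibleCharacters (G : Type*) [Group G] : Set (G → ℂ) :=
  {χ | ∃ (n : ℕ) (R : Representation ℂ G (Fin n → ℂ)),
    R.IsIrreducible ∧ χ = R.character}

/-- `cd(G) = {χ(1) ∣ χ ∈ Irr(G)}`: the set of irreducible complex character degrees of `G`. -/
def characterDegrees (G : Type*) [Group G] : Set ℕ :=
  {d | ∃ χ ∈ irreducibleCharacters G, χ 1 = (d : ℂ)}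

/-- `cd(G)* = cd(G) \ {1}`: the nontrivial character degrees. -/
def nontrivialDegrees (G : Type*) [Group G] : Set ℕ :=
  characterDegrees G \ {1}

/-- `ρ(G)`: the primes that divide some element of `cd(G)*`. -/
def degreePrimes (G : Type*) [Group G] : Set ℕ :=
  {p | p.Prime ∧ ∃ d ∈ nontrivialDegrees G, p ∣ d}

/-- The bipartite graph on the disjoint union `α ⊕ β` in which `a : α` and `b : β` are adjacent
if and only if `r a b`. -/
def bipartiteGraph {α β : Type*} (r : α → β → Prop) : SimpleGraph (α ⊕ β) where
  Adj v w := (∃ a b, v = Sum.inl a ∧ w = Sum.inr b ∧ r a b) ∨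
    (∃ a b, w = Sum.inl a ∧ v = Sum.inr b ∧ r a b)
  symm := ⟨fun _ _ h => h.symm⟩
  loopless := ⟨fun v h => by
    rcases h with ⟨a, b, h1, h2, _⟩ | ⟨a, b, h1, h2, _⟩ <;> simp [h1] at h2⟩

/-- The bipartite divisor graph `B(G)`: its vertices are the primes in `ρ(G)` (left) and the
degrees in `cd(G)*` (right), with `p` adjacent to `d` if and only if `p` divides `d`. -/
def bipartiteDivisorGraph (G : Type*) [Group G] :
    SimpleGraph (degreePrimes G ⊕ nontrivialDegrees G) :=
  bipartiteGraph fun p d => (p : ℕ) ∣ (d : ℕ)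

/-- The graph with two prime vertices `0, 1` (left) and three degree vertices `0, 1, 2` (right):
the prime `0` is joined to the degrees `0` and `1`, and the prime `1` is joined to the
degree `2`. -/
def twoPlusOneGraph : SimpleGraph (Fin 2 ⊕ Fin 3) :=
  bipartiteGraph fun p d => (p = 0 ∧ d = 0) ∨ (p = 0 ∧ d = 1) ∨ (p = 1 ∧ d = 2)

/-- The Fitting subgroup of `G`: the subgroup generated by all normal nilpotent subgroups. -/
def fittingSubgroup (G : Type*) [Group G] : Subgroup G :=
  sSup {N : Subgroup G | N.Normal ∧ Group.IsNilpotent N}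

/-- `G` is a group of Lewis type 4: `G = V ⋊ H` for an elementary abelian `p`-group `V`; with
`Z = C_H(V)`, `K = F(H)` and `m = |H : K|`, one has `m > 1`, `|V| = q ^ m` for some power `q` of
`p`, `Z ≤ Z(H)`, `K / Z` is abelian, `K` acts irreducibly on `V`, `m` and `|K : Z|` are coprime,
and `(q ^ m - 1) / (q - 1)` divides `|K : Z|`. -/
def IsLewisType4 (G : Type*) [Group G] : Prop :=
  ∃ (V H : Subgroup G) (p q : ℕ),
    -- `G` is the internal semidirect product of the normal subgroup `V` and `H`
    V.Normal ∧ V.IsComplement' H ∧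
    -- `V` is an elementary abelian `p`-group
    p.Prime ∧ (∀ v ∈ V, ∀ w ∈ V, v * w = w * v) ∧ (∀ v ∈ V, v ^ p = 1) ∧
    -- `q` is a power of `p`
    (∃ a : ℕ, 0 < a ∧ q = p ^ a) ∧
    ∃ Z K : Subgroup H,
      Z = (Subgroup.centralizer (V : Set G)).subgroupOf H ∧ K = fittingSubgroup H ∧
      1 < K.index ∧ Nat.card V = q ^ K.index ∧
      Z ≤ Subgroup.center H ∧
      -- `K / Z` is abelian
      ⁅K, K⁆ ≤ Z ∧
      -- `K` acts irreducibly on `V` by conjugation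
      V ≠ ⊥ ∧ (∀ W ≤ V, (∀ k ∈ K, ∀ w ∈ W, (k : G) * w * (k : G)⁻¹ ∈ W) → W = ⊥ ∨ W = V) ∧
      K.index.Coprime (Z.relIndex K) ∧
      (q ^ K.index - 1) / (q - 1) ∣ Z.relIndex K

/-! Let t = |K:Z| and m = |H:K|. In the given graph every degree meets exactly one prime, so all
nontrivial degrees are prime powers, and there are three of them. The Lewis type 4 structure leaves
room for only two, namely m and t. The action of K generates a finite commutative domain in End(V).
Hence K/Z is cyclic, and K is abelian because Z is central (`mul_comm_of_irreducible_of_commute`).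
An irreducible representation nontrivial on V has degree t·j with j ≤ m
(`exists_degree_eq_relIndex_mul`): its restriction to K has trace zero off Z, and it is spanned by
the H/Z-translates of a V-eigenvector. Such a representation exists, so t is a power of a prime s.
As (q^m - 1)/(q - 1) divides t, the order of q modulo s is m, which forces m to be prime and m < s
(`Nat.prime_and_lt_of_geomSum_dvd_prime_pow`). Then j ≤ m < s and t·j a power of s give j = 1, while
representations trivial on V have degree 1 or m because K is abelian, normal and of prime index in
H. -/

namespace Representation

/-! ### Clifford theory over ℂ for a normal subgroup of prime index -/

section Irreducible

variable {G W : Type*} [Group G] [AddCommGroup W] [Module ℂ W] (ρ : Representation ℂ G W)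

theorem isIrreducible_iff_forall_submodule :
    ρ.IsIrreducible ↔ Nontrivial W ∧
      ∀ U : Submodule ℂ W, (∀ g, ∀ w ∈ U, ρ g w ∈ U) → U = ⊥ ∨ U = ⊤ := by
  constructor
  · intro h
    constructor
    · by_contra hW
      rw [not_nontrivial_iff_subsingleton] at hW
      obtain ⟨a, b, hab⟩ := h.toNontrivial
      exact hab (Subrepresentation.toSubmodule_injective (Subsingleton.elim _ _))
    · intro U hU
      rcases h.eq_bot_or_eq_top ⟨U, fun g w hw => hU g w hw⟩ with h1 | h1
      · exact Or.inl (congrArg Subrepresentation.toSubmodule h1)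
      · exact Or.inr (congrArg Subrepresentation.toSubmodule h1)
  · rintro ⟨hW, h⟩
    refine @IsSimpleOrder.mk _ _ _ ⟨⊥, ⊤, ?_⟩ ?_
    · intro hbt
      exact bot_ne_top (α := Submodule ℂ W) (congrArg Subrepresentation.toSubmodule hbt)
    · intro U
      rcases h U.toSubmodule (fun g w hw => U.apply_mem_toSubmodule g hw) with h1 | h1
      · exact Or.inl (Subrepresentation.toSubmodule_injective h1)
      · exact Or.inr (Subrepresentation.toSubmodule_injective h1)

variable {ρ}

theorem IsIrreducible.nontrivial' (h : ρ.IsIrreducible) : Nontrivial W :=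
  ((isIrreducible_iff_forall_submodule ρ).1 h).1

theorem IsIrreducible.eq_bot_or_eq_top_of_invariant (h : ρ.IsIrreducible) (U : Submodule ℂ W)
    (hU : ∀ g, ∀ w ∈ U, ρ g w ∈ U) : U = ⊥ ∨ U = ⊤ :=
  ((isIrreducible_iff_forall_submodule ρ).1 h).2 U hU

theorem IsIrreducible.eq_top_of_mem (h : ρ.IsIrreducible) (U : Submodule ℂ W)
    (hU : ∀ g, ∀ w ∈ U, ρ g w ∈ U) {w : W} (hw : w ∈ U) (hw0 : w ≠ 0) : U = ⊤ := by
  rcases h.eq_bot_or_eq_top_of_invariant U hU with h1 | h1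
  · rw [h1, Submodule.mem_bot] at hw
    exact absurd hw hw0
  · exact h1

theorem isIrreducible_conj {W' : Type*} [AddCommGroup W'] [Module ℂ W'] (e : W ≃ₗ[ℂ] W')
    (R : Representation ℂ G W') (hR : ∀ g w, R g (e w) = e (ρ g w)) (h : ρ.IsIrreducible) :
    R.IsIrreducible := by
  rw [isIrreducible_iff_forall_submodule] at h ⊢
  obtain ⟨hW, h⟩ := h
  refine ⟨e.symm.toEquiv.nontrivial, fun U hU => ?_⟩
  have hinj : Function.Injective (Submodule.comap (e : W →ₗ[ℂ] W')) :=
    Submodule.comap_injective_of_surjective e.surjective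
  rcases h (U.comap (e : W →ₗ[ℂ] W')) (fun g w hw => by
    have := hU g _ hw
    simpa [hR] using this) with h1 | h1
  · left
    apply hinj
    rw [h1]
    ext w
    simp
  · right
    apply hinj
    rw [h1, Submodule.comap_top]

/-- Schur's lemma. -/
theorem IsIrreducible.exists_eq_smul_of_commute [FiniteDimensional ℂ W] (h : ρ.IsIrreducible)
    (f : W →ₗ[ℂ] W) (hf : ∀ g w, f (ρ g w) = ρ g (f w)) : ∃ c : ℂ, ∀ w, f w = c • w := by
  have := h.nontrivial'
  obtain ⟨c, hc⟩ := Module.End.exists_eigenvalue f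
  obtain ⟨w, hw⟩ := hc.exists_hasEigenvector
  have htop := h.eq_top_of_mem (Module.End.eigenspace f c) (fun g w hw => by
    rw [Module.End.mem_eigenspace_iff] at hw ⊢
    rw [hf, hw, map_smul]) hw.1 hw.2
  refine ⟨c, fun w => ?_⟩
  rw [← Module.End.mem_eigenspace_iff, htop]
  trivial

/-- A subgroup acting by commuting operators has a common eigenvector. -/
theorem exists_common_eigenvector [FiniteDimensional ℂ W] [Nontrivial W]
    (ρ : Representation ℂ G W) (A : Subgroup G)
    (hA : ∀ a ∈ A, ∀ b ∈ A, Commute (ρ a) (ρ b)) :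
    ∃ (ψ : G → ℂ) (w : W), w ≠ 0 ∧ ∀ a ∈ A, ρ a w = ψ a • w := by
  -- On a minimal nonzero A-invariant subspace each operator is scalar: its eigenspace there is
  -- again A-invariant.
  obtain ⟨U, ⟨hU0, hU⟩, hmin⟩ := wellFounded_lt.has_min
    {U : Submodule ℂ W | U ≠ ⊥ ∧ ∀ a ∈ A, ∀ w ∈ U, ρ a w ∈ U} ⟨⊤, top_ne_bot, by simp⟩
  have key : ∀ a ∈ A, ∃ c : ℂ, ∀ w ∈ U, ρ a w = c • w := by
    intro a ha
    have : Nontrivial U := Submodule.nontrivial_iff_ne_bot.2 hU0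
    obtain ⟨c, hc⟩ := Module.End.exists_eigenvalue ((ρ a).restrict (hU a ha))
    obtain ⟨w, hw⟩ := hc.exists_hasEigenvector
    have hw1 : ρ a w = c • (w : W) := by
      simpa using! congrArg Subtype.val (Module.End.mem_eigenspace_iff.1 hw.1)
    let E := U ⊓ Module.End.eigenspace (ρ a) c
    have hE : E = U := by
      by_contra hne
      refine hmin E ⟨?_, ?_⟩ (lt_of_le_of_ne inf_le_left hne)
      · intro hbot
        have : (w : W) ∈ E := ⟨w.2, Module.End.mem_eigenspace_iff.2 hw1⟩
        rw [hbot, Submodule.mem_bot] at this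
        exact hw.2 (Subtype.ext this)
      · rintro b hb x ⟨hx, hx'⟩
        refine ⟨hU b hb x hx, ?_⟩
        rw [SetLike.mem_coe, Module.End.mem_eigenspace_iff] at hx' ⊢
        have := LinearMap.congr_fun (hA a ha b hb).eq x
        simp only [Module.End.mul_apply] at this
        rw [this, hx', map_smul]
    refine ⟨c, fun x hx => ?_⟩
    rw [← hE] at hx
    exact Module.End.mem_eigenspace_iff.1 hx.2
  choose! ψ hψ using key
  obtain ⟨w, hw, hw0⟩ := Submodule.exists_mem_ne_zero_of_ne_bot hU0
  exact ⟨ψ, w, hw0, fun a ha => hψ a ha w hw⟩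

/-- The orbit of w lies on the lines through the vectors `ρ (x i) w`, and the span of an orbit is
invariant, hence everything. -/
theorem IsIrreducible.finrank_le_card (h : ρ.IsIrreducible) {ι : Type*} [Fintype ι]
    {w : W} (hw : w ≠ 0) (x : ι → G) (hx : ∀ g, ∃ i, ∃ c : ℂ, ρ g w = c • ρ (x i) w) :
    Module.finrank ℂ W ≤ Fintype.card ι := by
  let U := Submodule.span ℂ (Set.range fun i => ρ (x i) w)
  have hU : ∀ g, ρ g w ∈ U := fun g => by
    obtain ⟨i, c, hc⟩ := hx g
    rw [hc]
    exact U.smul_mem c (Submodule.subset_span ⟨i, rfl⟩)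
  have htop : U = ⊤ := by
    refine h.eq_top_of_mem U (fun g u hu => ?_) (w := w) (by simpa using hU 1) hw
    refine (Submodule.span_le (p := U.comap (ρ g))).2 ?_ hu
    rintro _ ⟨i, rfl⟩
    have := hU (g * x i)
    rwa [map_mul] at this
  rw [← finrank_top, ← htop]
  exact finrank_range_le_card _

theorem linearIndependent_of_joint_eigenvectors {ι κ : Type*} (f : κ → Module.End ℂ W)
    (hf : ∀ i j, Commute (f i) (f j)) (v : ι → W) (hv : ∀ i, v i ≠ 0) (χ : ι → κ → ℂ)
    (hχ : Function.Injective χ) (h : ∀ i k, f k (v i) = χ i k • v i) : LinearIndependent ℂ v := by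
  have h1 := Module.End.independent_iInf_maxGenEigenspace_of_forall_mapsTo f
    (fun i j φ => Module.End.mapsTo_maxGenEigenspace_of_comm (hf j i) φ)
  refine (h1.comp hχ).linearIndependent _ (fun i => ?_) hv
  simp only [Function.comp_apply, Submodule.mem_iInf]
  intro k
  exact Module.End.genEigenspace_le_maximal (f k) (χ i k) 1
    (Module.End.mem_eigenspace_iff.2 (h i k))

theorem eq_or_eq_top_of_index_prime {K T : Subgroup G} (hK : K.index.Prime) (hKT : K ≤ T) :
    T ≤ K ∨ T = ⊤ := by
  have h := Subgroup.relIndex_mul_index hKT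
  rw [← h] at hK
  rcases Nat.prime_mul_iff.1 hK with ⟨_, h1⟩ | ⟨_, h1⟩
  · exact Or.inr (Subgroup.index_eq_one.1 h1)
  · exact Or.inl (Subgroup.relIndex_eq_one.1 h1)

/-- The degrees of a group with a normal subgroup of prime index acting by commuting operators. -/
theorem IsIrreducible.finrank_eq_one_or_index [Finite G] [FiniteDimensional ℂ W]
    (h : ρ.IsIrreducible) (K : Subgroup G) [K.Normal] (hp : K.index.Prime)
    (hK : ∀ a ∈ K, ∀ b ∈ K, Commute (ρ a) (ρ b)) :
    Module.finrank ℂ W = 1 ∨ Module.finrank ℂ W = K.index := by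
  have := h.nontrivial'
  have hpos : 0 < Module.finrank ℂ W := Module.finrank_pos
  obtain ⟨ψ, w, hw, hψ⟩ := exists_common_eigenvector ρ K hK
  have hinv : ∀ g w, ρ g⁻¹ (ρ g w) = w := fun g w => by
    rw [← Module.End.mul_apply, ← map_mul]; simp
  have hcomm : ∀ a ∈ K, ∀ b ∈ K, ∀ u, ρ (b⁻¹ * a * b) u = ρ a u := by
    intro a ha b hb u
    have := LinearMap.congr_fun (hK a ha b hb).eq u
    simp only [Module.End.mul_apply] at this
    rw [map_mul, map_mul, Module.End.mul_apply, Module.End.mul_apply, this, hinv]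
  -- The stabilizer of the weight ψ. It contains K, so by primality of the index it is K or all of
  -- G.
  let T : Subgroup G :=
    { carrier := {g | ∀ k ∈ K, ψ (g⁻¹ * k * g) = ψ k}
      one_mem' := by simp
      mul_mem' := by
        intro a b ha hb k hk
        have h1 := hb (a⁻¹ * k * a) (by simpa using Subgroup.Normal.conj_mem ‹K.Normal› k hk a⁻¹)
        rw [ha k hk] at h1
        rw [← h1]
        congr 1
        group
      inv_mem' := by
        intro a ha k hk
        have h1 := ha (a * k * a⁻¹) (Subgroup.Normal.conj_mem ‹K.Normal› k hk a)
        rw [inv_inv, ← h1]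
        congr 1
        group }
  have hKT : K ≤ T := by
    intro g hg k hk
    have h1 := hψ (g⁻¹ * k * g) (K.mul_mem (K.mul_mem (K.inv_mem hg) hk) hg)
    rw [hcomm k hk g hg, hψ k hk] at h1
    exact (smul_left_injective ℂ hw h1).symm
  have hweight : ∀ g, ∀ k ∈ K, ρ k (ρ g w) = ψ (g⁻¹ * k * g) • ρ g w := by
    intro g k hk
    have h1 := hψ (g⁻¹ * k * g) (by simpa using Subgroup.Normal.conj_mem ‹K.Normal› k hk g⁻¹)
    rw [← map_smul, ← h1, ← Module.End.mul_apply, ← Module.End.mul_apply, ← map_mul, ← map_mul]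
    congr 2
    group
  rcases eq_or_eq_top_of_index_prime hp hKT with hT | hT
  -- The conjugates of ψ are pairwise distinct, so the coset translates of w are independent; they
  -- also span.
  · right
    have hfin : Fintype (G ⧸ K) := Fintype.ofFinite _
    have hcard : Fintype.card (G ⧸ K) = K.index := by
      rw [Subgroup.index, Nat.card_eq_fintype_card]
    apply le_antisymm
    · rw [← hcard]
      refine h.finrank_le_card hw (fun c : G ⧸ K => c.out) fun g => ⟨g, ?_⟩
      obtain ⟨k, hk⟩ := QuotientGroup.mk_out_eq_mul K g
      refine ⟨ψ (k : G)⁻¹, ?_⟩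
      rw [hk, ← map_smul, ← hψ _ (K.inv_mem k.2), ← Module.End.mul_apply, ← map_mul]
      simp
    · rw [← hcard]
      refine LinearIndependent.fintype_card_le_finrank (R := ℂ) (b := fun c : G ⧸ K => ρ c.out w)
        (linearIndependent_of_joint_eigenvectors (fun k : K => ρ k)
        (fun i j => hK _ i.2 _ j.2) _ (fun c => ?_) (fun c k => ψ (c.out⁻¹ * k * c.out)) ?_ ?_)
      · intro h0
        apply hw
        rw [← hinv c.out w, h0, map_zero]
      · intro c d hcd
        have hmem : c.out⁻¹ * d.out ∈ K := by
          apply hT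
          intro k hk
          have := congrFun hcd ⟨c.out * k * c.out⁻¹, Subgroup.Normal.conj_mem ‹K.Normal› k hk _⟩
          simp only at this
          rw [show c.out⁻¹ * (c.out * k * c.out⁻¹) * c.out = k by group] at this
          rw [this]
          congr 1
          group
        rw [← QuotientGroup.eq] at hmem
        simpa using hmem
      · intro c k
        exact hweight _ _ k.2
  · left
    -- Here ψ is G-invariant, so its weight space is invariant and K acts by scalars.
    have hscal : ∀ k ∈ K, ∀ u, ρ k u = ψ k • u := by
      intro k hk u
      have htop := h.eq_top_of_mem (⨅ k : K, Module.End.eigenspace (ρ k) (ψ k)) (w := w) ?_ ?_ hw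
      · have : u ∈ (⨅ k : K, Module.End.eigenspace (ρ k) (ψ k)) := by rw [htop]; trivial
        rw [Submodule.mem_iInf] at this
        exact Module.End.mem_eigenspace_iff.1 (this ⟨k, hk⟩)
      · intro g u hu
        rw [Submodule.mem_iInf] at hu ⊢
        intro a
        have hg : g ∈ T := by rw [hT]; trivial
        have h1 := Module.End.mem_eigenspace_iff.1 (hu ⟨g⁻¹ * a * g, by
          simpa using Subgroup.Normal.conj_mem ‹K.Normal› a a.2 g⁻¹⟩)
        simp only [hg a a.2] at h1
        rw [Module.End.mem_eigenspace_iff, ← map_smul, ← h1, ← Module.End.mul_apply,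
          ← Module.End.mul_apply, ← map_mul, ← map_mul]
        congr 2
        group
      · rw [Submodule.mem_iInf]
        exact fun a => Module.End.mem_eigenspace_iff.2 (hψ a a.2)
    have hall : ∀ g, ∃ c : ℂ, ∀ u, ρ g u = c • u := by
      intro g
      by_cases hg : g ∈ K
      · exact ⟨_, hscal g hg⟩
      apply h.exists_eq_smul_of_commute
      -- The elements commuting with g under ρ include K and g itself, hence all of G; Schur then
      -- makes `ρ g` scalar.
      let C : Subgroup G :=
        { carrier := {x | Commute (ρ g) (ρ x)}
          one_mem' := by simp
          mul_mem' := by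
            intro a b ha hb
            simp only [Set.mem_ofPred_eq, map_mul] at ha hb ⊢
            exact ha.mul_right hb
          inv_mem' := by
            intro a ha
            simp only [Set.mem_ofPred_eq] at ha ⊢
            have h1 : ρ a * ρ a⁻¹ = 1 := by rw [← map_mul]; simp
            have h2 : ρ a⁻¹ * ρ a = 1 := by rw [← map_mul]; simp
            exact Commute.units_inv_right (u := ⟨ρ a, ρ a⁻¹, h1, h2⟩) ha }
      have hC : K ≤ C := by
        intro k hk
        ext u
        simp [hscal k hk]
      have hCtop : C = ⊤ := by
        refine (eq_or_eq_top_of_index_prime hp hC).resolve_left fun hle => hg (hle ?_)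
        exact Commute.refl (ρ g)
      intro x u
      have hx : x ∈ C := by rw [hCtop]; trivial
      exact LinearMap.congr_fun hx.eq u
    have := h.finrank_le_card hw (fun _ : Unit => 1) (fun g => by
      obtain ⟨c, hc⟩ := hall g
      exact ⟨(), c, by simpa using hc w⟩)
    rw [Fintype.card_unit] at this
    omega

end Irreducible

/-! ### Traces: divisibility and vanishing -/

section Characters

variable {G W : Type*} [Group G] [Finite G] [AddCommGroup W] [Module ℂ W]

/-- If a subgroup `Z` acts by scalars and the character vanishes outside `Z`, then the degree is a
multiple of the index of `Z`. -/
theorem index_dvd_finrank_of_trace_eq_zero [FiniteDimensional ℂ W] [Nontrivial W]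
    (ρ : Representation ℂ G W)
    (hG : ∀ a b : G, a * b = b * a) (Z : Subgroup G) (hZ : ∀ z ∈ Z, ∃ c : ℂ, ∀ w, ρ z w = c • w)
    (htr : ∀ g, g ∉ Z → LinearMap.trace ℂ W (ρ g) = 0) : Z.index ∣ Module.finrank ℂ W := by
  classical
  have := Fintype.ofFinite G
  obtain ⟨ψ, w, hw, hψ⟩ := exists_common_eigenvector ρ ⊤ (fun a _ b _ => by
    rw [Commute, SemiconjBy, ← map_mul, hG, map_mul])
  replace hψ : ∀ a, ρ a w = ψ a • w := fun a => hψ a (Subgroup.mem_top a)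
  have hψ1 : ψ 1 = 1 := by
    have := hψ 1
    rw [map_one, Module.End.one_apply] at this
    exact smul_left_injective ℂ hw (by simpa using this.symm)
  have hψm : ∀ a b, ψ (a * b) = ψ a * ψ b := fun a b => by
    have := hψ (a * b)
    rw [map_mul, Module.End.mul_apply, hψ, map_smul, hψ, smul_smul, mul_comm] at this
    exact smul_left_injective ℂ hw this.symm
  -- Twisting by the inverse of ψ makes Z act trivially, so the average of the character is dim W /
  -- |G:Z|; it is an integer, being the dimension of the invariants.
  let τ : Representation ℂ G W :=
    { toFun := fun g => ψ g⁻¹ • ρ g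
      map_one' := by simp [hψ1]
      map_mul' := fun a b => by
        rw [mul_inv_rev, hψm, map_mul, smul_mul_smul_comm, mul_comm (ψ b⁻¹)] }
  have htop : (Nat.card G : ℂ) ≠ 0 := by exact_mod_cast Nat.card_pos.ne'
  have : Invertible (Nat.card G : ℂ) := invertibleOfNonzero htop
  have hsum := τ.card_inv_mul_sum_char_eq_finrank
  have hval : ∀ g, τ.character g = if g ∈ Z then (Module.finrank ℂ W : ℂ) else 0 := by
    intro g
    change LinearMap.trace ℂ W (ψ g⁻¹ • ρ g) = _
    rw [map_smul]
    split_ifs with hg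
    · obtain ⟨c, hc⟩ := hZ g hg
      have hcψ : c = ψ g := smul_left_injective ℂ hw ((hc w).symm.trans (hψ g))
      have : ρ g = c • LinearMap.id := by ext u; simp [hc]
      rw [this, map_smul, hcψ, LinearMap.trace_id, smul_smul, ← hψm]
      simp [hψ1]
    · rw [htr g hg, smul_zero]
  simp only [hval] at hsum
  rw [Finset.sum_ite, Finset.sum_const, Finset.sum_const_zero, add_zero] at hsum
  have hZc : (Finset.univ.filter (fun g => g ∈ Z)).card = Nat.card Z := by
    rw [Nat.card_eq_fintype_card, Fintype.card_subtype]
  rw [hZc, inv_mul_eq_iff_eq_mul₀ htop, nsmul_eq_mul] at hsum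
  have hnat : Nat.card Z * Module.finrank ℂ W = Nat.card G * Module.finrank ℂ τ.invariants := by
    exact_mod_cast hsum
  rw [← Z.card_mul_index, mul_assoc] at hnat
  exact ⟨_, Nat.eq_of_mul_eq_mul_left Nat.card_pos hnat⟩

/-- The sum of the operators of V has V-fixed image, so it vanishes. Every uk is conjugate to k, so
taking the trace of this sum times `ρ k` gives |V| · tr `ρ k` = 0. -/
theorem trace_eq_zero_of_conj (ρ : Representation ℂ G W) (V : Subgroup G)
    (hV : ∀ w, (∀ v ∈ V, ρ v w = w) → w = 0) (k : G)
    (hk : ∀ u ∈ V, ∃ v ∈ V, v * k * v⁻¹ = u * k) : LinearMap.trace ℂ W (ρ k) = 0 := by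
  classical
  have := Fintype.ofFinite V
  have h0 : ∑ u : V, ρ u = 0 := by
    ext w
    refine hV _ fun v hv => ?_
    rw [LinearMap.sum_apply, map_sum]
    refine Fintype.sum_equiv (Equiv.mulLeft (⟨v, hv⟩ : V)) _ _ fun u => ?_
    simp
  have h1 : LinearMap.trace ℂ W ((∑ u : V, ρ u) * ρ k) = 0 := by rw [h0]; simp
  rw [Finset.sum_mul, map_sum] at h1
  have h2 : ∀ u : V, LinearMap.trace ℂ W (ρ u * ρ k) = LinearMap.trace ℂ W (ρ k) := by
    intro u
    obtain ⟨v, -, hv⟩ := hk u u.2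
    rw [← map_mul, ← hv]
    exact ρ.char_conj k v
  simp only [h2, Finset.sum_const, nsmul_eq_mul] at h1
  have hc : ((Finset.univ : Finset V).card : ℂ) ≠ 0 := by
    rw [Finset.card_univ]
    exact_mod_cast Fintype.card_ne_zero
  exact (mul_eq_zero.1 h1).resolve_left hc

end Characters

open scoped MonoidAlgebra in
/-- Every nontrivial element of a finite group acts nontrivially in some irreducible
representation. -/
theorem exists_isIrreducible_apply_ne_one {G : Type*} [Group G] [Finite G] {g : G} (hg : g ≠ 1) :
    ∃ (n : ℕ) (R : Representation ℂ G (Fin n → ℂ)), R.IsIrreducible ∧ R g ≠ 1 := by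
  classical
  have := Fintype.ofFinite G
  have : NeZero (Nat.card G : ℂ) := ⟨by exact_mod_cast Nat.card_pos.ne'⟩
  -- By Maschke the simple left ideals span the group algebra; if g fixed them all pointwise it
  -- would fix 1.
  obtain ⟨S, hS, x, hx, hgx⟩ : ∃ S : Submodule ℂ[G] ℂ[G], IsSimpleModule ℂ[G] S ∧
      ∃ x ∈ S, MonoidAlgebra.of ℂ G g * x ≠ x := by
    by_contra! hcon
    have hall : ∀ x : ℂ[G], MonoidAlgebra.of ℂ G g * x = x := by
      intro x
      have hx : x ∈ ⨆ S : {S : Submodule ℂ[G] ℂ[G] | IsSimpleModule ℂ[G] S},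
          (S : Submodule ℂ[G] ℂ[G]) := by
        rw [← sSup_eq_iSup', IsSemisimpleModule.sSup_simples_eq_top]
        trivial
      refine Submodule.iSup_induction _ (motive := fun x => MonoidAlgebra.of ℂ G g * x = x) hx
        (fun S y hy => hcon S S.2 y hy) (mul_zero _) (fun y z hy hz => ?_)
      rw [mul_add, hy, hz]
    have h1 := hall 1
    rw [mul_one, ← map_one (MonoidAlgebra.of ℂ G)] at h1
    exact hg (MonoidAlgebra.of_injective h1)
  let ρ : Representation ℂ G S :=
    ((Algebra.lsmul ℂ ℂ S : ℂ[G] →ₐ[ℂ] Module.End ℂ S) : ℂ[G] →* Module.End ℂ S).comp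
      (MonoidAlgebra.of ℂ G)
  have hρa : ∀ a (s : S), ρ a s = MonoidAlgebra.of ℂ G a • s := fun a s => rfl
  have hρ : ρ.IsIrreducible := by
    rw [isIrreducible_iff_forall_submodule]
    refine ⟨IsSimpleModule.nontrivial ℂ[G] S, fun U hU => ?_⟩
    let U' : Submodule ℂ[G] S :=
      { U.toAddSubmonoid with
        smul_mem' := by
          intro c u hu
          induction c using MonoidAlgebra.induction_on with
          | of a => exact hU a u hu
          | add a b ha hb => rw [add_smul]; exact U.add_mem ha hb
          | smul r a ha => rw [smul_assoc]; exact U.smul_mem r ha }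
    have hmem : ∀ u, u ∈ U' ↔ u ∈ U := fun u => Iff.rfl
    rcases eq_bot_or_eq_top U' with h1 | h1
    · left
      ext u
      rw [← hmem, h1, Submodule.mem_bot, Submodule.mem_bot]
    · right
      ext u
      rw [← hmem, h1]
      simp
  have hfin : FiniteDimensional ℂ S :=
    FiniteDimensional.finiteDimensional_submodule (S.restrictScalars ℂ)
  let e : S ≃ₗ[ℂ] (Fin (Module.finrank ℂ S) → ℂ) := (Module.finBasis ℂ S).equivFun
  let R : Representation ℂ G (Fin (Module.finrank ℂ S) → ℂ) :=
    { toFun := fun a => e.conj (ρ a)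
      map_one' := by rw [map_one]; exact e.conj_id
      map_mul' := fun a b => by rw [map_mul]; exact e.conj_comp _ _ }
  have hR : ∀ a w, R a (e w) = e (ρ a w) := fun a w => by
    change e.conj (ρ a) (e w) = _
    rw [LinearEquiv.conj_apply_apply, LinearEquiv.symm_apply_apply]
  refine ⟨_, R, isIrreducible_conj e R hR hρ, fun h1 => hgx ?_⟩
  have h2 := hR g ⟨x, hx⟩
  rw [h1, Module.End.one_apply, hρa] at h2
  exact (congrArg Subtype.val (e.injective h2)).symm

end Representation

/-- Write Φ(x, n) = 1 + x + ⋯ + x^(n-1). For m = uv, Φ(q, m) = Φ(q, u) · Φ(q^u, v), and each factor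
exceeding 1 is divisible by s. This makes q of order exactly m modulo s and excludes proper factors
of m; finally m divides s - 1. -/
theorem Nat.prime_and_lt_of_geomSum_dvd_prime_pow {q m s c : ℕ} (hq : 2 ≤ q) (hm : 1 < m)
    (hs : s.Prime) (hcop : m.Coprime (s ^ c)) (hdvd : (q ^ m - 1) / (q - 1) ∣ s ^ c) :
    m.Prime ∧ m < s := by
  have : Fact s.Prime := ⟨hs⟩
  rw [← Nat.geomSum_eq hq] at hdvd
  have hone : ∀ x n : ℕ, 2 ≤ x → 1 < n → 1 < ∑ k ∈ Finset.range n, x ^ k := by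
    intro x n hx hn
    obtain ⟨n, rfl⟩ := Nat.exists_eq_add_of_lt hn
    rw [show 1 + n + 1 = (n + 1) + 1 by ring, Finset.sum_range_succ', Finset.sum_range_succ',
      pow_zero]
    have : 0 < x ^ (0 + 1) := by positivity
    omega
  have hsdvd : ∀ x, 1 < x → x ∣ s ^ c → s ∣ x := by
    intro x hx hxc
    obtain ⟨j, -, rfl⟩ := (Nat.dvd_prime_pow hs).1 hxc
    exact dvd_pow_self s (by rintro rfl; simp at hx)
  have hfac : ∀ u v, m = u * v → ∑ k ∈ Finset.range m, q ^ k =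
      (∑ k ∈ Finset.range u, q ^ k) * ∑ k ∈ Finset.range v, (q ^ u) ^ k := by
    rintro u v rfl
    have h1 := geom_sum_mul (q : ℤ) (u * v)
    have h2 := geom_sum_mul (q : ℤ) u
    have h3 := geom_sum_mul ((q : ℤ) ^ u) v
    rw [← h2, ← pow_mul, ← h1] at h3
    have hq0 : (q : ℤ) - 1 ≠ 0 := by omega
    have h4 : (∑ k ∈ Finset.range (u * v), (q : ℤ) ^ k) =
        (∑ k ∈ Finset.range u, (q : ℤ) ^ k) * ∑ k ∈ Finset.range v, ((q : ℤ) ^ u) ^ k := by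
      apply mul_right_cancel₀ hq0
      rw [← h3]
      ring
    exact_mod_cast h4
  have hpow : ∀ u, s ∣ ∑ k ∈ Finset.range u, q ^ k → (q : ZMod s) ^ u = 1 := by
    intro u hu
    have h1 := geom_sum_mul (q : ZMod s) u
    rw [← ZMod.natCast_eq_zero_iff] at hu
    push_cast at hu
    rw [hu, zero_mul] at h1
    exact (sub_eq_zero.1 h1.symm)
  have hsm : s ∣ ∑ k ∈ Finset.range m, q ^ k := hsdvd _ (hone q m hq hm) hdvd
  have hne : ∀ u, 0 < u → u ∣ m → (q : ZMod s) ^ u = 1 → u = m := by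
    rintro u hu ⟨v, hv⟩ h1
    -- If q^u ≡ 1, the second factor is ≡ v modulo s, so s divides v and hence m, against
    -- coprimality.
    have hv1 : ¬ 1 < v := by
      intro hv1
      have hB := hsdvd _ (hone (q ^ u) v (hq.trans (Nat.le_self_pow hu.ne' q)) hv1)
        ((Dvd.intro_left _ (hfac u v hv).symm).trans hdvd)
      rw [← ZMod.natCast_eq_zero_iff] at hB
      push_cast at hB
      simp only [h1, one_pow, Finset.sum_const, Finset.card_range, nsmul_eq_mul, mul_one] at hB
      rw [ZMod.natCast_eq_zero_iff] at hB
      have hc : s ∣ s ^ c := hsm.trans hdvd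
      exact hs.one_lt.ne' (Nat.dvd_one.1 (hcop ▸ Nat.dvd_gcd (hB.trans ⟨u, by rw [hv]; ring⟩) hc))
    have : v ≠ 0 := by rintro rfl; omega
    have : v = 1 := by omega
    rw [hv, this, mul_one]
  have hqm : (q : ZMod s) ^ m = 1 := hpow m hsm
  have hord : orderOf (q : ZMod s) = m :=
    hne _ (orderOf_pos_iff.2 (isOfFinOrder_iff_pow_eq_one.2 ⟨m, by omega, hqm⟩))
      (orderOf_dvd_of_pow_eq_one hqm) (pow_orderOf_eq_one _)
  constructor
  · by_contra hp
    obtain ⟨u, hu, hu1, hum⟩ := Nat.exists_dvd_of_not_prime2 hm hp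
    obtain ⟨v, hv⟩ := hu
    have h1 := hpow u (hsdvd _ (hone q u hq (by omega))
      ((Dvd.intro _ (hfac u v hv).symm).trans hdvd))
    have := Nat.le_of_dvd (by omega) (hord ▸ orderOf_dvd_of_pow_eq_one h1)
    omega
  · have h0 : (q : ZMod s) ≠ 0 := by
      intro h0
      rw [h0, zero_pow (by omega)] at hqm
      exact zero_ne_one hqm
    have h1 := ZMod.orderOf_dvd_card_sub_one h0
    rw [hord] at h1
    have := Nat.le_of_dvd (by have := hs.two_le; omega) h1
    have := hs.two_le
    omega

/-! ### Irreducible actions through an abelian quotient -/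

section IrreducibleAction

variable {G : Type*} [Group G] {V K : Subgroup G}

/-- If `K` acts irreducibly on `V` through an abelian quotient, then `v ↦ v k v⁻¹ k⁻¹` maps `V` onto
itself for every `k ∈ K` acting nontrivially. -/
theorem exists_conj_eq_mul_of_irreducible_of_commute (hVn : V.Normal)
    (hV : ∀ v ∈ V, ∀ w ∈ V, v * w = w * v)
    (hirr : ∀ W ≤ V, (∀ k ∈ K, ∀ w ∈ W, k * w * k⁻¹ ∈ W) → W = ⊥ ∨ W = V)
    (hK : ∀ a ∈ K, ∀ b ∈ K, ∀ v ∈ V, a * (b * v * b⁻¹) * a⁻¹ = b * (a * v * a⁻¹) * b⁻¹)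
    {k : G} (hk : k ∈ K) (hkV : ¬ ∀ v ∈ V, k * v * k⁻¹ = v) {u : G} (hu : u ∈ V) :
    ∃ v ∈ V, v * k * v⁻¹ = u * k := by
  have hmem : ∀ a, ∀ v ∈ V, a * v * a⁻¹ ∈ V := fun a v hv => hVn.conj_mem v hv a
  -- The commutators [v, k] form a subgroup since V is abelian, and K preserves it since K acts
  -- through commuting automorphisms.
  let W : Subgroup G :=
    { carrier := {x | ∃ v ∈ V, v * (k * v⁻¹ * k⁻¹) = x}
      one_mem' := ⟨1, V.one_mem, by simp⟩
      mul_mem' := by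
        rintro _ _ ⟨v, hv, rfl⟩ ⟨w, hw, rfl⟩
        refine ⟨v * w, V.mul_mem hv hw, ?_⟩
        have h1 := hV _ (hmem k _ (V.inv_mem hv)) _ hw
        have h2 := hV _ (hmem k _ (V.inv_mem hv)) _ (hmem k _ (V.inv_mem hw))
        calc v * w * (k * (v * w)⁻¹ * k⁻¹)
            = v * w * ((k * w⁻¹ * k⁻¹) * (k * v⁻¹ * k⁻¹)) := by group
          _ = v * (w * (k * v⁻¹ * k⁻¹)) * (k * w⁻¹ * k⁻¹) := by rw [← h2]; group
          _ = v * (k * v⁻¹ * k⁻¹) * (w * (k * w⁻¹ * k⁻¹)) := by rw [← h1]; group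
      inv_mem' := by
        rintro _ ⟨v, hv, rfl⟩
        refine ⟨v⁻¹, V.inv_mem hv, ?_⟩
        rw [hV _ (V.inv_mem hv) _ (hmem k _ (V.inv_mem (V.inv_mem hv)))]
        group }
  have hWV : W ≤ V := by
    rintro _ ⟨v, hv, rfl⟩
    exact V.mul_mem hv (hmem k _ (V.inv_mem hv))
  rcases hirr W hWV (by
    rintro a ha _ ⟨v, hv, rfl⟩
    refine ⟨a * v * a⁻¹, hmem a v hv, ?_⟩
    have h1 := hK k hk a ha v⁻¹ (V.inv_mem hv)
    rw [show (a * v * a⁻¹)⁻¹ = a * v⁻¹ * a⁻¹ by group, h1]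
    group) with h | h
  · exfalso
    apply hkV
    intro v hv
    have h1 : v⁻¹ * (k * v⁻¹⁻¹ * k⁻¹) ∈ W := ⟨v⁻¹, V.inv_mem hv, rfl⟩
    rw [h, Subgroup.mem_bot, inv_inv] at h1
    exact (inv_mul_eq_one.1 h1).symm
  · rw [← h] at hu
    obtain ⟨v, hv, rfl⟩ := hu
    exact ⟨v, hv, by group⟩

open scoped IsMulCommutative in
/-- If `K` acts irreducibly on a finite abelian group `V` through an abelian quotient and the kernel
of the action is central, then `K` is abelian. -/
theorem mul_comm_of_irreducible_of_commute [Finite V] (hVn : V.Normal)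
    (hV : ∀ v ∈ V, ∀ w ∈ V, v * w = w * v) (hV0 : V ≠ ⊥)
    (hirr : ∀ W ≤ V, (∀ k ∈ K, ∀ w ∈ W, k * w * k⁻¹ ∈ W) → W = ⊥ ∨ W = V)
    (hK : ∀ a ∈ K, ∀ b ∈ K, ∀ v ∈ V, a * (b * v * b⁻¹) * a⁻¹ = b * (a * v * a⁻¹) * b⁻¹)
    (hZ : ∀ k ∈ K, (∀ v ∈ V, k * v * k⁻¹ = v) → ∀ a ∈ K, k * a = a * k)
    {a b : G} (ha : a ∈ K) (hb : b ∈ K) : a * b = b * a := by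
  let _ : CommGroup V := { (inferInstance : Group V) with
    mul_comm := fun v w => Subtype.ext (hV v v.2 w w.2) }
  let E := AddMonoid.End (Additive V)
  let f : K →* E :=
    { toFun := fun k => MonoidHom.toAdditive ((MulAut.conjNormal (k : G) : MulAut V) : V →* V)
      map_one' := by ext v; simp; rfl
      map_mul' := fun k l => by ext v; simp; rfl }
  have hf : ∀ (k : K) (v : V), ((f k (Additive.ofMul v)).toMul : G) = k * v * (k : G)⁻¹ :=
    fun k v => rfl
  let R := Subring.closure (Set.range f)
  have hcomm : IsMulCommutative R := Subring.isMulCommutative_closure (by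
    rintro _ ⟨k, rfl⟩ _ ⟨l, rfl⟩
    ext v
    exact hK k k.2 l l.2 (Additive.toMul v : V) (Additive.toMul v : V).2)
  have hfR : ∀ k, f k ∈ R := fun k => Subring.subset_closure ⟨k, rfl⟩
  -- The kernel of x is K-invariant because R is commutative; irreducibility makes nonzero elements
  -- injective, so R is a domain.
  have hker : ∀ x : R, x ≠ 0 → ∀ v, (x : E) v = 0 → v = 0 := by
    intro x hx v hv
    let W : Subgroup G := Subgroup.map V.subtype (AddSubgroup.toSubgroup' (AddMonoidHom.ker (x : E)))
    have hW : ∀ v : V, (v : G) ∈ W ↔ (x : E) (Additive.ofMul v) = 0 := by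
      intro v
      constructor
      · rintro ⟨w, hw, hwv⟩
        have : w = v := Subtype.ext hwv
        rw [← this]
        exact hw
      · intro h
        exact ⟨v, h, rfl⟩
    have hWV : W ≤ V := Subgroup.map_subtype_le _
    rcases hirr W hWV (by
      intro k hk w hw
      have h1 : ((⟨k * w * k⁻¹, hVn.conj_mem w (hWV hw) k⟩ : V) : G) ∈ W := by
        rw [hW]
        have h2 := (hW ⟨w, hWV hw⟩).1 hw
        have h3 : (x : E) * f ⟨k, hk⟩ = f ⟨k, hk⟩ * x :=
          congrArg Subtype.val (hcomm.is_comm.comm x ⟨f ⟨k, hk⟩, hfR _⟩)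
        have h4 := DFunLike.congr_fun h3 (Additive.ofMul ⟨w, hWV hw⟩)
        change (x : E) (f ⟨k, hk⟩ _) = f ⟨k, hk⟩ ((x : E) _) at h4
        rw [h2, map_zero] at h4
        exact h4
      exact h1) with h | h
    · have h1 := (hW v.toMul).2 hv
      rw [h, Subgroup.mem_bot] at h1
      exact Additive.toMul.injective (Subtype.ext h1)
    · exfalso
      apply hx
      apply Subtype.ext
      ext w
      have h1 : ((Additive.toMul w : V) : G) ∈ W := by rw [h]; exact w.2
      rw [hW] at h1
      exact congrArg (fun t : Additive V => ((Additive.toMul t : V) : G)) h1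
  have : Nontrivial V := (Subgroup.nontrivial_iff_ne_bot V).2 hV0
  have : Nontrivial R := by
    obtain ⟨v, hv⟩ := exists_ne (1 : V)
    refine ⟨0, 1, fun h01 => hv ?_⟩
    exact (DFunLike.congr_fun (congrArg Subtype.val h01) (Additive.ofMul v)).symm
  have : NoZeroDivisors R := ⟨fun {x y} hxy => by
    by_contra! hcon
    apply hcon.2
    apply Subtype.ext
    ext v
    have h1 : (x : E) ((y : E) v) = 0 := DFunLike.congr_fun (congrArg Subtype.val hxy) v
    rw [hker x hcon.1 _ h1]
    rfl⟩
  have : IsDomain R := NoZeroDivisors.to_isDomain R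
  have : Finite E := DFunLike.finite E
  let F : K →* Rˣ := (f.codRestrict R hfR).toHomUnits
  have hF : F.ker ≤ Subgroup.center K := by
    intro k hk
    have h1 : f k = 1 := congrArg (fun u : Rˣ => ((u : R) : E)) (MonoidHom.mem_ker.1 hk)
    rw [Subgroup.mem_center_iff]
    intro l
    refine Subtype.ext (hZ k k.2 (fun v hv => ?_) l l.2).symm
    have h2 := hf k ⟨v, hv⟩
    rw [h1] at h2
    exact h2.symm
  -- A finite group of units of a domain is cyclic, and a group that is cyclic modulo a central
  -- subgroup is abelian.
  exact congrArg Subtype.val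
    ((F.isMulCommutative_of_isCyclic_of_ker_le_center hF).is_comm.comm ⟨a, ha⟩ ⟨b, hb⟩)

end IrreducibleAction

theorem mem_characterDegrees_iff {G : Type*} [Group G] {d : ℕ} :
    d ∈ characterDegrees G ↔ ∃ R : Representation ℂ G (Fin d → ℂ), R.IsIrreducible := by
  constructor
  · rintro ⟨_, ⟨n, R, hR, rfl⟩, h⟩
    rw [R.char_one, Module.finrank_fin_fun] at h
    obtain rfl : n = d := by exact_mod_cast h
    exact ⟨R, hR⟩
  · rintro ⟨R, hR⟩
    exact ⟨_, ⟨d, R, hR, rfl⟩, by rw [R.char_one, Module.finrank_fin_fun]⟩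

/-! ### What the graph says about the degrees -/

section Graph

variable {G : Type*} [Group G]

/-- Each degree vertex of `twoPlusOneGraph` has a single neighbour, so nontrivial degrees are
divisible by at most one prime. -/
theorem prime_eq_prime_of_dvd_degree (e : bipartiteDivisorGraph G ≃g twoPlusOneGraph)
    (he : ∀ v, (e v).isLeft = v.isLeft) {d : ℕ} (hd : d ∈ nontrivialDegrees G) {p p' : ℕ}
    (hp : p.Prime) (hp' : p'.Prime) (hpd : p ∣ d) (hpd' : p' ∣ d) : p = p' := by
  let P : degreePrimes G := ⟨p, hp, d, hd, hpd⟩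
  let P' : degreePrimes G := ⟨p', hp', d, hd, hpd'⟩
  obtain ⟨j, hj⟩ := Sum.isRight_iff.1 (show (e (Sum.inr ⟨d, hd⟩)).isRight by
    rw [← Sum.not_isLeft, he]; simp)
  obtain ⟨i, hi⟩ := Sum.isLeft_iff.1 (show (e (Sum.inl P)).isLeft by rw [he]; rfl)
  obtain ⟨i', hi'⟩ := Sum.isLeft_iff.1 (show (e (Sum.inl P')).isLeft by rw [he]; rfl)
  have h1 : twoPlusOneGraph.Adj (Sum.inl i) (Sum.inr j) := by
    rw [← hi, ← hj, e.map_adj_iff]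
    exact Or.inl ⟨_, _, rfl, rfl, hpd⟩
  have h2 : twoPlusOneGraph.Adj (Sum.inl i') (Sum.inr j) := by
    rw [← hi', ← hj, e.map_adj_iff]
    exact Or.inl ⟨_, _, rfl, rfl, hpd'⟩
  have hii : i = i' := by
    simp only [twoPlusOneGraph, bipartiteGraph] at h1 h2
    fin_cases i <;> fin_cases i' <;> fin_cases j <;> simp_all
  have h3 : e (Sum.inl P) = e (Sum.inl P') := by rw [hi, hi', hii]
  exact congrArg Subtype.val (Sum.inl.inj (e.injective h3))

theorem not_nontrivialDegrees_subset_pair (e : bipartiteDivisorGraph G ≃g twoPlusOneGraph)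
    (he : ∀ v, (e v).isLeft = v.isLeft) (a b : ℕ) :
    ¬ nontrivialDegrees G ⊆ {a, b} := by
  intro hsub
  have hex : ∀ j : Fin 3, ∃ d : nontrivialDegrees G, e (Sum.inr d) = Sum.inr j := by
    intro j
    obtain ⟨d, hd⟩ := Sum.isRight_iff.1 (show (e.symm (Sum.inr j)).isRight by
      rw [← Sum.not_isLeft, ← he]; simp)
    exact ⟨d, by rw [← hd]; simp⟩
  choose D hD using hex
  have hinj : Function.Injective fun j => (D j : ℕ) := by
    intro i j hij
    have h1 : D i = D j := Subtype.ext hij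
    have h2 := hD i
    rw [h1, hD j] at h2
    exact (Sum.inr.inj h2).symm
  have h1 : Finset.univ.image (fun j => (D j : ℕ)) ⊆ {a, b} := by
    intro x hx
    obtain ⟨j, -, rfl⟩ := Finset.mem_image.1 hx
    simpa using hsub (D j).2
  have h2 := Finset.card_le_card h1
  rw [Finset.card_image_of_injective _ hinj, Finset.card_univ, Fintype.card_fin] at h2
  exact absurd (h2.trans Finset.card_le_two) (by norm_num)

end Graph

instance fittingSubgroup_normal (G : Type*) [Group G] : (fittingSubgroup G).Normal :=
  Subgroup.sSup_normal _ fun _ h => h.1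

theorem le_fittingSubgroup_of_le_center {G : Type*} [Group G] {Z : Subgroup G}
    (hZ : Z ≤ Subgroup.center G) : Z ≤ fittingSubgroup G := by
  refine le_sSup ⟨⟨fun z hz g => ?_⟩, ?_⟩
  · rw [Subgroup.mem_center_iff.1 (hZ hz) g]
    simpa using hz
  · have : IsMulCommutative Z := ⟨⟨fun a b => Subtype.ext
      (Subgroup.mem_center_iff.1 (hZ b.2) a)⟩⟩
    open scoped IsMulCommutative in exact CommGroup.isNilpotent

/-! ### Degrees of V ⋊ H -/

section SemidirectDegrees

variable {G : Type*} [Group G] [Finite G] {V H : Subgroup G} {Z K : Subgroup H} {n : ℕ}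
  {ρ : Representation ℂ G (Fin n → ℂ)}

/-- The degrees of the irreducible representations of `V ⋊ H` that are trivial on `V`. -/
theorem degree_eq_one_or_index_of_trivial (hVH : V.IsComplement' H) [K.Normal]
    (hp : K.index.Prime) (hKc : ∀ a ∈ K, ∀ b ∈ K, a * b = b * a) (hρ : ρ.IsIrreducible)
    (htriv : ∀ v ∈ V, ρ v = 1) : n = 1 ∨ n = K.index := by
  let σ : Representation ℂ H (Fin n → ℂ) := MonoidHom.comp ρ H.subtype
  have hσ : σ.IsIrreducible := by
    rw [Representation.isIrreducible_iff_forall_submodule]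
    refine ⟨hρ.nontrivial', fun U hU => hρ.eq_bot_or_eq_top_of_invariant U fun g w hw => ?_⟩
    obtain ⟨⟨v, h⟩, rfl⟩ := hVH.surjective g
    simp only [map_mul]
    rw [htriv v v.2, one_mul]
    exact hU h w hw
  have := hσ.finrank_eq_one_or_index K hp (fun a ha b hb => by
    rw [Commute, SemiconjBy, ← map_mul, hKc a ha b hb, map_mul])
  rwa [Module.finrank_fin_fun] at this

/-- The degrees of the irreducible representations of `V ⋊ H` that are nontrivial on `V`, when `H`
has an abelian subgroup `K` that acts on `V` fixed-point-freely modulo its centralizer. -/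
theorem exists_degree_eq_relIndex_mul (hVn : V.Normal) (hVH : V.IsComplement' H)
    (hV : ∀ v ∈ V, ∀ w ∈ V, v * w = w * v) (hZV : ∀ z ∈ Z, ∀ v ∈ V, (z : G) * v = v * z)
    (hZ : Z ≤ Subgroup.center H) (hZK : Z ≤ K) (hKc : ∀ a ∈ K, ∀ b ∈ K, a * b = b * a)
    (hconj : ∀ k ∈ K, k ∉ Z → ∀ u ∈ V, ∃ v ∈ V, v * (k : G) * v⁻¹ = u * k)
    (hρ : ρ.IsIrreducible) (hnontriv : ¬ ∀ v ∈ V, ρ v = 1) :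
    ∃ j, n = Z.relIndex K * j ∧ j ≤ K.index := by
  have := hρ.nontrivial'
  have hscal : ∀ z ∈ Z, ∃ c : ℂ, ∀ w, ρ z w = c • w := by
    intro z hz
    refine hρ.exists_eq_smul_of_commute (ρ z) fun g w => ?_
    obtain ⟨⟨v, h⟩, rfl⟩ := hVH.surjective g
    have h1 : (h : G) * z = z * h := congrArg Subtype.val (Subgroup.mem_center_iff.1 (hZ hz) h)
    simp only
    rw [← Module.End.mul_apply, ← Module.End.mul_apply, ← map_mul, ← map_mul, mul_assoc, h1,
      ← mul_assoc, ← mul_assoc, hZV z hz v v.2]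
  -- V is normal, so its fixed space is G-invariant; it is proper because V acts nontrivially.
  have hfix : ∀ w, (∀ v ∈ V, ρ v w = w) → w = 0 := by
    by_contra! hcon
    obtain ⟨w, hw, hw0⟩ := hcon
    have htop := hρ.eq_top_of_mem (⨅ v : V, Module.End.eigenspace (ρ v) 1) (w := w) ?_ ?_ hw0
    · refine hnontriv fun v hv => LinearMap.ext fun x => ?_
      have hx : x ∈ (⨅ v : V, Module.End.eigenspace (ρ v) 1) := by rw [htop]; trivial
      rw [Submodule.mem_iInf] at hx
      simpa using Module.End.mem_eigenspace_iff.1 (hx ⟨v, hv⟩)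
    · intro g u hu
      rw [Submodule.mem_iInf] at hu ⊢
      intro v
      have h1 := Module.End.mem_eigenspace_iff.1
        (hu ⟨g⁻¹ * v * g, by simpa using hVn.conj_mem v v.2 g⁻¹⟩)
      rw [Module.End.mem_eigenspace_iff, one_smul] at *
      conv_rhs => rw [← h1]
      rw [← Module.End.mul_apply, ← Module.End.mul_apply, ← map_mul, ← map_mul]
      congr 2
      group
    · rw [Submodule.mem_iInf]
      exact fun v => Module.End.mem_eigenspace_iff.2 (by rw [one_smul]; exact hw v v.2)
  let τ : Representation ℂ K (Fin n → ℂ) := MonoidHom.comp ρ (H.subtype.comp K.subtype)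
  have hdvd := Representation.index_dvd_finrank_of_trace_eq_zero τ
    (fun a b => Subtype.ext (hKc a a.2 b b.2)) (Z.subgroupOf K)
    (fun z hz => hscal _ (Subgroup.mem_subgroupOf.1 hz))
    (fun k hk => Representation.trace_eq_zero_of_conj ρ V hfix _
      (hconj k k.2 (fun h => hk (Subgroup.mem_subgroupOf.2 h))))
  rw [Module.finrank_fin_fun] at hdvd
  obtain ⟨j, hj⟩ := hdvd
  refine ⟨j, hj, ?_⟩
  obtain ⟨ψ, w, hw, hψ⟩ := Representation.exists_common_eigenvector ρ V (fun a ha b hb => by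
    rw [Commute, SemiconjBy, ← map_mul, hV a ha b hb, map_mul])
  have hfin : Fintype (H ⧸ Z) := Fintype.ofFinite _
  -- V fixes the line of w and Z acts by scalars, so H/Z indexes a spanning set: n ≤ |H:Z| = |H:K| ·
  -- |K:Z|.
  have hle := hρ.finrank_le_card hw (fun c : H ⧸ Z => (c.out : G)) (fun g => by
    obtain ⟨⟨v, h⟩, hg⟩ := hVH.surjective g⁻¹
    obtain ⟨z, hz⟩ := QuotientGroup.mk_out_eq_mul Z h⁻¹
    obtain ⟨c, hc⟩ := hscal z⁻¹ (Z.inv_mem z.2)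
    refine ⟨(h⁻¹ : H), c * ψ (v : G)⁻¹, ?_⟩
    have hg' : g = ((h⁻¹ : H) * (z : H) : H) * (((z⁻¹ : Z) : H) : G) * (v : G)⁻¹ := by
      rw [← inv_inv g, ← hg]
      simp
    rw [hz]
    conv_lhs => rw [hg', map_mul, map_mul, Module.End.mul_apply, Module.End.mul_apply]
    rw [hψ _ (V.inv_mem v.2), map_smul, map_smul]
    have hc' : ρ (((z⁻¹ : Z) : H) : G) w = c • w := hc w
    rw [hc', map_smul, smul_smul, mul_comm])
  rw [Module.finrank_fin_fun, ← Nat.card_eq_fintype_card] at hle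
  change n ≤ Z.index at hle
  rw [← Subgroup.relIndex_mul_index hZK, hj] at hle
  exact Nat.le_of_mul_le_mul_left hle (Nat.pos_of_ne_zero Subgroup.index_ne_zero_of_finite)

end SemidirectDegrees

/-! ### The contradiction -/

theorem lemma2p6 {G : Type*} [Group G] [Finite G]
    (hB : ∃ e : bipartiteDivisorGraph G ≃g twoPlusOneGraph, ∀ v, (e v).isLeft = v.isLeft) :
    ¬ IsLewisType4 G := by
  obtain ⟨e, he⟩ := hB
  rintro ⟨V, H, p, q, hVn, hVH, hp, hV, -, ⟨a, ha, rfl⟩, Z, K, hZdef, hKdef, hm, -, hZc, hKZ, hV0,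
    hirr, hcop, hdvd⟩
  have hq : 2 ≤ p ^ a := hp.two_le.trans (Nat.le_self_pow ha.ne' p)
  have hKn : K.Normal := hKdef ▸ fittingSubgroup_normal H
  have hZK : Z ≤ K := hKdef ▸ le_fittingSubgroup_of_le_center hZc
  have hZmem : ∀ z : H, z ∈ Z ↔ ∀ v ∈ V, (z : G) * v * (z : G)⁻¹ = v := by
    intro z
    rw [hZdef, Subgroup.mem_subgroupOf, Subgroup.mem_centralizer_iff]
    exact forall₂_congr fun v _ => by rw [mul_inv_eq_iff_eq_mul, eq_comm]
  have hirr' : ∀ W ≤ V, (∀ k ∈ K.map H.subtype, ∀ w ∈ W, k * w * k⁻¹ ∈ W) → W = ⊥ ∨ W = V :=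
    fun W hW h => hirr W hW fun k hk => h k ⟨k, hk, rfl⟩
  have hact : ∀ a ∈ K.map H.subtype, ∀ b ∈ K.map H.subtype, ∀ v ∈ V,
      a * (b * v * b⁻¹) * a⁻¹ = b * (a * v * a⁻¹) * b⁻¹ := by
    rintro _ ⟨a, ha, rfl⟩ _ ⟨b, hb, rfl⟩ v hv
    have h1 := (hZmem _).1 (hKZ (Subgroup.commutator_mem_commutator ha hb))
      ((b * a : H) * v * (b * a : H)⁻¹) (hVn.conj_mem v hv _)
    rw [commutatorElement_def] at h1
    push_cast at h1
    simp only [Subgroup.coe_subtype]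
    calc _ = _ := by group
      _ = _ := h1
      _ = _ := by group
  have hKc : ∀ a ∈ K, ∀ b ∈ K, a * b = b * a := fun a ha b hb => Subtype.ext
    (mul_comm_of_irreducible_of_commute hVn hV hV0 hirr' hact (by
      rintro _ ⟨k, hk, rfl⟩ h _ ⟨b, hb, rfl⟩
      exact congrArg Subtype.val (Subgroup.mem_center_iff.1 (hZc ((hZmem k).2 h)) b).symm)
      ⟨a, ha, rfl⟩ ⟨b, hb, rfl⟩)
  have hconj : ∀ k ∈ K, k ∉ Z → ∀ u ∈ V, ∃ v ∈ V, v * (k : G) * v⁻¹ = u * k :=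
    fun k hk hkZ u hu => exists_conj_eq_mul_of_irreducible_of_commute hVn hV hirr' hact
      ⟨k, hk, rfl⟩ (fun h => hkZ ((hZmem k).2 h)) hu
  have hnontriv : ∀ {n : ℕ} {ρ : Representation ℂ G (Fin n → ℂ)}, ρ.IsIrreducible →
      (¬ ∀ v ∈ V, ρ v = 1) → ∃ j, n = Z.relIndex K * j ∧ j ≤ K.index := fun hρ h =>
    exists_degree_eq_relIndex_mul hVn hVH hV
      (fun z hz v hv => mul_inv_eq_iff_eq_mul.1 ((hZmem z).1 hz v hv)) hZc hZK hKc hconj hρ h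
  have hpos : ∀ {n : ℕ}, n ∈ nontrivialDegrees G → n ≠ 0 := by
    rintro n hn rfl
    obtain ⟨R, hR⟩ := mem_characterDegrees_iff.1 hn.1
    have := hR.nontrivial'
    exact not_subsingleton (Fin 0 → ℂ) inferInstance
  -- The quotient (q^m - 1)/(q - 1) is at least 1 + q since m ≥ 2.
  have ht : 1 < Z.relIndex K := by
    refine lt_of_lt_of_le ?_ (Nat.le_of_dvd (Nat.pos_of_ne_zero
      (Subgroup.index_ne_zero_of_finite)) hdvd)
    rw [← Nat.geomSum_eq hq]
    calc 1 < 1 + p ^ a := by omega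
      _ = ∑ k ∈ Finset.range 2, (p ^ a) ^ k := by simp [Finset.sum_range_succ]
      _ ≤ _ := Finset.sum_le_sum_of_subset (Finset.range_mono hm)
  obtain ⟨v, hvV, hv1⟩ := V.bot_or_exists_ne_one.resolve_left hV0
  obtain ⟨n, R, hR, hRv⟩ := Representation.exists_isIrreducible_apply_ne_one hv1
  obtain ⟨i, hni, -⟩ := hnontriv hR fun h => hRv (h v hvV)
  have hnd : n ∈ nontrivialDegrees G := by
    refine ⟨mem_characterDegrees_iff.2 ⟨R, hR⟩, fun h1 => ?_⟩
    rw [Set.mem_singleton_iff.1 h1] at hni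
    have := Nat.eq_one_of_mul_eq_one_right hni.symm
    omega
  obtain ⟨s, hs, hst⟩ := Nat.exists_prime_and_dvd ht.ne'
  obtain ⟨c, hc⟩ : ∃ c, Z.relIndex K = s ^ c :=
    ⟨_, Nat.eq_prime_pow_of_unique_prime_dvd (by omega) fun hl hlt =>
      prime_eq_prime_of_dvd_degree e he hnd hl hs (hlt.trans ⟨i, hni⟩) (hst.trans ⟨i, hni⟩)⟩
  obtain ⟨hmp, hms⟩ := Nat.prime_and_lt_of_geomSum_dvd_prime_pow hq hm hs (hc ▸ hcop) (hc ▸ hdvd)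
  refine not_nontrivialDegrees_subset_pair e he K.index (Z.relIndex K) fun d hd => ?_
  obtain ⟨ρ, hρ⟩ := mem_characterDegrees_iff.1 hd.1
  by_cases htriv : ∀ v ∈ V, ρ v = 1
  · exact Or.inl ((degree_eq_one_or_index_of_trivial hVH hmp hKc hρ htriv).resolve_left hd.2)
  · obtain ⟨j, hdj, hj⟩ := hnontriv hρ htriv
    -- A prime factor of j would have to be s, but j ≤ m < s.
    have hj1 : j = 1 := by
      by_contra hne
      obtain ⟨l, hl, hlj⟩ := Nat.exists_prime_and_dvd hne
      have hls : l = s := prime_eq_prime_of_dvd_degree e he hd hl hs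
        (hlj.trans ⟨_, by rw [hdj, mul_comm]⟩) (hst.trans ⟨j, hdj⟩)
      have hj0 : j ≠ 0 := by
        rintro rfl
        exact hpos hd hdj
      have := Nat.le_of_dvd (Nat.pos_of_ne_zero hj0) hlj
      omega
    right
    rw [Set.mem_singleton_iff, hdj, hj1, mul_one]
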